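/- Let $\mathbf{CartSp}$ be the category whose objects are the Cartesian spaces $\mathbb{R}^n$ ($n\in\mathbb{N}$) and whose morphisms $\mathbb{R}^m\to\mathbb{R}^n$ are the smooth (i.e. $C^\infty$) functions. Then $\mathbf{CartSp}$ has finite products, but it is not cartesian closed. More precisely, for every choice of finite products, the exponential $\mathbb{R}\Rightarrow\mathbb{R}$ does not exist in $\mathbf{CartSp}$: there are no object $E$ and morphism $\mathrm{ev}:\mathbb{R}\times E\to\mathbb{R}$ such that for every object $Z$ and every morphism $f:\mathbb{R}\times Z\to\mathbb{R}$ there is a unique morphism $g:Z\to E$ with $\mathrm{ev}\circ(\mathrm{id}_{\mathbb{R}}\times g)=f$. -/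

import Mathlib

open CategoryTheory CategoryTheory.Limits MonoidalCategory
open scoped ContDiff

/-- A cartesian space `ℝⁿ`, recorded by its dimension `n` (with `n = 0` allowed). -/
structure CartSp : Type where
  /-- the dimension -/
  dim : ℕ

namespace CartSp

/-- The underlying Euclidean space `ℝⁿ`. -/
abbrev Carrier (X : CartSp) : Type := EuclideanSpace ℝ (Fin X.dim)

/-- Morphisms of cartesian spaces: the smooth functions `ℝᵐ → ℝⁿ`. -/
@[ext]
structure Hom (X Y : CartSp) : Type where
  /-- the underlying function -/
  toFun : X.Carrier → Y.Carrier
  /-- the function is infinitely differentiable -/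
  smooth : ContDiff ℝ ∞ toFun

/-- The category of cartesian spaces and smooth functions. -/
instance : Category CartSp where
  Hom X Y := Hom X Y
  id X := ⟨fun x => x, contDiff_id⟩
  comp f g := ⟨fun x => g.toFun (f.toFun x), g.smooth.comp f.smooth⟩

/-- The real line `ℝ = ℝ¹` as a cartesian space. -/
def real : CartSp := ⟨1⟩

end CartSp

/-- The exponential `X ⇒ Y` exists in a category with finite products: there are an object `E` and
an evaluation morphism `ev : X × E ⟶ Y` such that each `f : X × Z ⟶ Y` is of the form
`(id × g) ≫ ev` for exactly one `g : Z ⟶ E`. -/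
def HasExponential {C : Type*} [Category C] [CartesianMonoidalCategory C] (X Y : C) : Prop :=
  ∃ (E : C) (ev : X ⊗ E ⟶ Y), ∀ (Z : C) (f : X ⊗ Z ⟶ Y), ∃! g : Z ⟶ E, X ◁ g ≫ ev = f

/-!
`ℝᵐ⁺ⁿ ≅ ℝᵐ × ℝⁿ` and the one-point space `ℝ⁰` give finite products. An exponential object for
`ℝ ⇒ ℝ` would be a finite-dimensional space carrying all polynomials, hence too small: if the family
`(t, a) ↦ ∑ₖ aₖ tᵏ` of polynomials of degree `< n` is `ev ∘ (id × g)` with `g : ℝⁿ → E`, then for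
each `t` the linear form `a ↦ ∑ₖ aₖ tᵏ` factors smoothly through `g`, so by the chain rule it
vanishes on the kernel of the derivative of `g` at `0`. These forms have no common zero but `0`, so
this derivative is injective and `n ≤ dim E`, which fails for `n = dim E + 1`.
-/

section Analysis

theorem finrank_le_finrank_of_separating_hasFDerivAt_comp {𝕜 V W F ι : Type*}
    [NontriviallyNormedField 𝕜] [NormedAddCommGroup V] [NormedSpace 𝕜 V]
    [NormedAddCommGroup W] [NormedSpace 𝕜 W] [FiniteDimensional 𝕜 W]
    [NormedAddCommGroup F] [NormedSpace 𝕜 F]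
    {g : V → W} {v : V} {k : ι → W → F} {L : ι → V →L[𝕜] F}
    (hg : DifferentiableAt 𝕜 g v) (hk : ∀ i, DifferentiableAt 𝕜 (k i) (g v))
    (hL : ∀ i, HasFDerivAt (k i ∘ g) (L i) v) (hsep : ∀ u, (∀ i, L i u = 0) → u = 0) :
    Module.finrank 𝕜 V ≤ Module.finrank 𝕜 W := by
  have chain_rule (i : ι) : L i = (fderiv 𝕜 (k i) (g v)).comp (fderiv 𝕜 g v) :=
    (hL i).unique ((hk i).hasFDerivAt.comp v hg.hasFDerivAt)
  have ker_eq_zero (u : V) (hu : fderiv 𝕜 g v u = 0) : u = 0 :=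
    hsep u fun i => by rw [chain_rule, ContinuousLinearMap.comp_apply, hu, map_zero]
  exact LinearMap.finrank_le_finrank_of_injective (f := (fderiv 𝕜 g v).toLinearMap)
    ((injective_iff_map_eq_zero _).2 ker_eq_zero)

/-- The moment curve `t ↦ (1, t, …, tⁿ⁻¹)` in `ℝⁿ`. Its inner product with `a` is the value at `t`
of the polynomial with coefficients `a`. -/
def momentCurve (n : ℕ) (t : ℝ) : EuclideanSpace ℝ (Fin n) :=
  WithLp.toLp 2 fun k => t ^ (k : ℕ)

theorem contDiff_momentCurve (n : ℕ) {r : WithTop ℕ∞} : ContDiff ℝ r (momentCurve n) :=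
  contDiff_euclidean.2 fun k => contDiff_id.pow k

theorem eq_zero_of_forall_inner_momentCurve_eq_zero {n : ℕ} {a : EuclideanSpace ℝ (Fin n)}
    (h : ∀ t, inner ℝ (momentCurve n t) a = 0) : a = 0 := by
  have nodes_injective : Function.Injective fun j : Fin n => ((j : ℕ) : ℝ) :=
    Nat.cast_injective.comp Fin.val_injective
  have coeff_eq_zero : a.ofLp = 0 :=
    Matrix.eq_zero_of_forall_index_sum_mul_pow_eq_zero nodes_injective fun j => by
      simpa [momentCurve, PiLp.inner_apply] using h j
  ext k
  exact congrFun coeff_eq_zero k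

end Analysis

namespace CartSp

section FiniteProducts

instance : HasTerminal CartSp :=
  IsTerminal.hasTerminal <| IsTerminal.ofUniqueHom (Y := ⟨0⟩)
    (fun _ => ⟨fun _ => 0, contDiff_const⟩)
    fun _ _ => Hom.ext <| funext fun _ => PiLp.ext finZeroElim

/-- The product `ℝᵐ⁺ⁿ` of `ℝᵐ` and `ℝⁿ`. -/
def prod (X Y : CartSp) : CartSp := ⟨X.dim + Y.dim⟩

/-- The identification of `ℝᵐ⁺ⁿ` with `ℝᵐ × ℝⁿ`, through which the universal property of the
product is inherited from that of pairs. -/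
noncomputable def prodEquiv (X Y : CartSp) : (prod X Y).Carrier ≃L[ℝ] X.Carrier × Y.Carrier :=
  EuclideanSpace.finAddEquivProd

/-- The binary fan exhibiting `CartSp.prod X Y` as a product, with the two blocks of coordinates as
projections. -/
noncomputable def prodFan (X Y : CartSp) : BinaryFan X Y :=
  BinaryFan.mk (P := prod X Y)
    ⟨fun p => (prodEquiv X Y p).1, contDiff_fst.comp (prodEquiv X Y).contDiff⟩
    ⟨fun p => (prodEquiv X Y p).2, contDiff_snd.comp (prodEquiv X Y).contDiff⟩

noncomputable def prodFanIsLimit (X Y : CartSp) : IsLimit (prodFan X Y) :=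
  BinaryFan.IsLimit.mk _
    (fun f g => ⟨fun z => (prodEquiv X Y).symm (f.toFun z, g.toFun z),
      (prodEquiv X Y).symm.contDiff.comp (f.smooth.prodMk g.smooth)⟩)
    (fun f g => Hom.ext <| funext fun z =>
      congrArg Prod.fst ((prodEquiv X Y).apply_symm_apply (f.toFun z, g.toFun z)))
    (fun f g => Hom.ext <| funext fun z =>
      congrArg Prod.snd ((prodEquiv X Y).apply_symm_apply (f.toFun z, g.toFun z)))
    (by
      rintro T f g m rfl rfl
      exact Hom.ext <| funext fun z => ((prodEquiv X Y).symm_apply_apply (m.toFun z)).symm)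

instance : HasFiniteProducts CartSp :=
  have (X Y : CartSp) : HasLimit (pair X Y) := ⟨⟨_, prodFanIsLimit X Y⟩⟩
  have := hasBinaryProducts_of_hasLimit_pair CartSp
  hasFiniteProducts_of_has_binary_and_terminal

end FiniteProducts

section Slices

/-- The constant morphism with value `x`. -/
def const (Z : CartSp) {X : CartSp} (x : X.Carrier) : Z ⟶ X := ⟨fun _ => x, contDiff_const⟩

variable [CartesianMonoidalCategory CartSp] {X Y Z E : CartSp}

open CartesianMonoidalCategory SemiCartesianMonoidalCategory

/-- The partial map `f(x, -)` of a morphism `f` out of a product. -/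
def slice (f : X ⊗ Z ⟶ Y) (x : X.Carrier) : Z ⟶ Y := lift (const Z x) (𝟙 Z) ≫ f

theorem slice_whiskerLeft_comp (g : Z ⟶ E) (f : X ⊗ E ⟶ Y) (x : X.Carrier) :
    slice (X ◁ g ≫ f) x = g ≫ slice f x := by
  have comp_const : g ≫ const E x = const Z x := rfl
  simp [slice, comp_lift_assoc, comp_const]

/-- The family `(x, a) ↦ (∑ₖ aₖ xᵢᵏ) • y` of polynomial maps from `X` to the line spanned by `y`,
parametrized by their coefficients `a` in `Z`. -/
noncomputable def polynomialFamily (Z : CartSp) (i : Fin X.dim) (y : Y.Carrier) : X ⊗ Z ⟶ Y where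
  toFun p := inner ℝ (momentCurve Z.dim ((fst X Z).toFun p i)) ((snd X Z).toFun p) • y
  smooth := (((contDiff_momentCurve Z.dim).comp (contDiff_euclidean.1 (fst X Z).smooth i)).inner ℝ
    (snd X Z).smooth).smul contDiff_const

theorem slice_polynomialFamily_toFun (i : Fin X.dim) (y : Y.Carrier) (x : X.Carrier) :
    (slice (polynomialFamily Z i y) x).toFun =
      (innerSL ℝ (momentCurve Z.dim (x i))).smulRight y := by
  funext a
  have fst_eq := congrArg (fun h : Hom Z X => h.toFun a) (lift_fst (const Z x) (𝟙 Z))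
  have snd_eq := congrArg (fun h : Hom Z Z => h.toFun a) (lift_snd (const Z x) (𝟙 Z))
  exact congrArg₂ (fun u b => inner ℝ (momentCurve Z.dim (u.ofLp i)) b • y) fst_eq snd_eq

theorem dim_le_of_whiskerLeft_comp_eq_polynomialFamily {ev : X ⊗ E ⟶ Y} {g : Z ⟶ E} {i : Fin X.dim}
    {y : Y.Carrier} (hy : y ≠ 0) (h : X ◁ g ≫ ev = polynomialFamily Z i y) : Z.dim ≤ E.dim := by
  have differentiable {A B : CartSp} (f : A ⟶ B) : Differentiable ℝ f.toFun :=
    f.smooth.differentiable (by simp)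
  have comp_slice (x : X.Carrier) : (slice ev x).toFun ∘ g.toFun =
      (innerSL ℝ (momentCurve Z.dim (x i))).smulRight y := by
    rw [← slice_polynomialFamily_toFun, ← h, slice_whiskerLeft_comp]
    rfl
  have finrank_le : Module.finrank ℝ Z.Carrier ≤ Module.finrank ℝ E.Carrier :=
    finrank_le_finrank_of_separating_hasFDerivAt_comp (v := 0) (differentiable g 0)
      (fun x : X.Carrier => differentiable (slice ev x) _)
      (fun x => comp_slice x ▸ ContinuousLinearMap.hasFDerivAt _)
      fun a ha => eq_zero_of_forall_inner_momentCurve_eq_zero fun t => by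
        simpa [hy] using ha (EuclideanSpace.single i t)
  simpa using finrank_le

theorem exists_forall_whiskerLeft_comp_ne (hX : X.dim ≠ 0) (hY : Y.dim ≠ 0) (ev : X ⊗ E ⟶ Y) :
    ∃ (Z : CartSp) (f : X ⊗ Z ⟶ Y), ∀ g : Z ⟶ E, X ◁ g ≫ ev ≠ f := by
  have : Nonempty (Fin Y.dim) := Fin.pos_iff_nonempty.1 (Nat.pos_of_ne_zero hY)
  obtain ⟨y, hy⟩ := exists_ne (0 : Y.Carrier)
  exact ⟨⟨E.dim + 1⟩, polynomialFamily _ ⟨0, Nat.pos_of_ne_zero hX⟩ y, fun _ h =>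
    Nat.not_succ_le_self E.dim (dim_le_of_whiskerLeft_comp_eq_polynomialFamily hy h)⟩

end Slices

end CartSp

theorem HasExponential.of_closed {C : Type*} [Category C] [CartesianMonoidalCategory C]
    (X Y : C) [Closed X] : HasExponential X Y :=
  ⟨(ihom X).obj Y, (ihom.ev X).app Y, fun _ f =>
    ⟨MonoidalClosed.curry f, MonoidalClosed.whiskerLeft_curry_ihom_ev_app _ _ f, fun g hg =>
      (MonoidalClosed.eq_curry_iff f g).2 ((MonoidalClosed.uncurry_eq g).trans hg)⟩⟩

/-- No `ev` is even weakly universal, so `X ⇒ Y` fails to exist also as a weak exponential. -/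
theorem mainTheorem7_general :
    HasFiniteProducts CartSp ∧
      ∀ [CartesianMonoidalCategory CartSp] {X Y E : CartSp}, X.dim ≠ 0 → Y.dim ≠ 0 →
        ∀ ev : X ⊗ E ⟶ Y, ∃ (Z : CartSp) (f : X ⊗ Z ⟶ Y), ∀ g : Z ⟶ E, X ◁ g ≫ ev ≠ f :=
  ⟨inferInstance, CartSp.exists_forall_whiskerLeft_comp_ne⟩

theorem mainTheorem7 :
    HasFiniteProducts CartSp ∧
      ∀ [CartesianMonoidalCategory CartSp],
        ¬ HasExponential CartSp.real CartSp.real ∧ IsEmpty (MonoidalClosed CartSp) := by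
  refine ⟨mainTheorem7_general.1, fun {_} => ?_⟩
  have not_hasExponential : ¬ HasExponential CartSp.real CartSp.real := fun ⟨_, ev, h⟩ =>
    have ⟨Z, f, hf⟩ := mainTheorem7_general.2 one_ne_zero one_ne_zero ev
    (h Z f).exists.elim hf
  exact ⟨not_hasExponential, ⟨fun _ => not_hasExponential (.of_closed _ _)⟩⟩
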